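/- Proposition (Aubin–Lions compactness). Let $X$, $B$, $Y$ be Banach spaces (over the same field $\mathbb R$ or $\mathbb C$), let $1\le p<\infty$ and $T>0$. Assume that $X\hookrightarrow B\hookrightarrow Y$ continuously, that the resulting embedding $X\hookrightarrow Y$ is compact, and that there exist $\theta\in(0,1)$ and $C_\theta>0$ such that $$\|u\|_B\le C_\theta\,\|u\|_X^{1-\theta}\,\|u\|_Y^{\theta}\qquad\text{for all }u\in X.$$ Let $(u_i)_{i\in I}$ be a family (for instance a sequence) of functions $u_i:(0,T]\to X$ with time steps $\tau_i>0$ such that, for each $i$, $T=N_i\tau_i$ for some $N_i\in\mathbb N$ and $u_i$ is constant on each subinterval $((k-1)\tau_i,k\tau_i]$, $1\le k\le N_i$. Assume that (i) $(u_i)$ is bounded in $L^p(0,T;X)$; (ii) there exists $C>0$ such that for all $i\in I$, $\;\|u_i(\cdot+\tau_i)-u_i\|_{L^1(0,T-\tau_i;B)}\le C\tau_i$. Then $\{u_i : i\in I\}$ is relatively compact in $L^q(0,T;B)$ for every real $q$ with $p\le q<p/(1-\theta)$. -/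

import Mathlib

open MeasureTheory Set

open scoped ENNReal

/-- Lebesgue measure on the time interval `(a, b)`, so that `L^p(a, b; E)` is
`MeasureTheory.Lp E p (timeMeasure a b)`. -/
noncomputable def timeMeasure (a b : ℝ) : Measure ℝ :=
  volume.restrict (Ioo a b)

/-- `u` is constant on each subinterval `((k - 1) τ, k τ]`, `1 ≤ k ≤ N`, of `(0, T]`,
where `T = N τ`. -/
def IsPiecewiseConstantInTime {E : Type*} (T τ : ℝ) (u : ℝ → E) : Prop :=
  ∃ N : ℕ, T = N * τ ∧
    ∀ k : ℕ, 1 ≤ k → k ≤ N →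
      ∃ c : E, ∀ t ∈ Ioc (((k : ℝ) - 1) * τ) ((k : ℝ) * τ), u t = c

/-- The family `u` is contained and bounded in `L^p(0, T; E)`. -/
def IsBoundedInLp {ι E : Type*} [NormedAddCommGroup E] (p : ℝ≥0∞) (T : ℝ)
    (u : ι → ℝ → E) : Prop :=
  (∀ i, MemLp (u i) p (timeMeasure 0 T)) ∧
    ∃ M : ℝ, ∀ i, eLpNorm (u i) p (timeMeasure 0 T) ≤ ENNReal.ofReal M

/-- The family `u` is contained in `L^q(0, T; E)`, and the set of its classes has compact closure
in that space. The `Fact` (needed for the norm of the space) and the membership in the space are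
part of what is asserted. -/
def IsRelativelyCompactInLp {ι E : Type*} [NormedAddCommGroup E] (q : ℝ≥0∞) (T : ℝ)
    (u : ι → ℝ → E) : Prop :=
  ∃ _ : Fact (1 ≤ q), ∃ h : ∀ i, MemLp (u i) q (timeMeasure 0 T),
    IsCompact (closure (range fun i => (h i).toLp (u i)))

/-!
Condition (ii) bounds a variation: for a function constant on intervals of length `τ`, the `L^1`
norm of the shift by `τ` is `τ` times the sum of the jumps, so the total variation in `B` of all
the `u i` is at most `C`. A function of variation at most `V` lies within `h ^ (1 / q) * V`, in
`L^q`, of the step function sampling it once in each cell of length `h`. By (i) the sampling points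
can be chosen so that the samples are bounded in `X`, hence lie in a compact subset of `B`: by
interpolation against the compact embedding into `Y`, the embedding of `X` into `B` is itself
compact. Step functions on a fixed finite partition with values in a compact set form a compact
subset of `L^q`, so the family is totally bounded.
-/

open Filter Topology

theorem totallyBounded_of_forall_exists_totallyBounded_edist_lt {α : Type*} [PseudoEMetricSpace α]
    {s : Set α}
    (h : ∀ ε : ℝ≥0∞, 0 < ε → ∃ t, TotallyBounded t ∧ ∀ x ∈ s, ∃ y ∈ t, edist x y < ε) :
    TotallyBounded s := by
  refine EMetric.totallyBounded_iff.2 fun ε hε => ?_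
  obtain ⟨t, ht, hst⟩ := h (ε / 2) (ENNReal.half_pos hε.ne')
  obtain ⟨F, hF, htF⟩ := EMetric.totallyBounded_iff.1 ht (ε / 2) (ENNReal.half_pos hε.ne')
  refine ⟨F, hF, fun x hx => ?_⟩
  obtain ⟨y, hy, hxy⟩ := hst x hx
  obtain ⟨z, hz, hyz⟩ := mem_iUnion₂.1 (htF hy)
  refine mem_iUnion₂.2 ⟨z, hz, ?_⟩
  calc edist x z ≤ edist x y + edist y z := edist_triangle _ _ _
    _ < ε / 2 + ε / 2 := ENNReal.add_lt_add hxy hyz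
    _ = ε := ENNReal.add_halves ε

theorem totallyBounded_image_of_forall_dist_lt {α β γ : Type*} [PseudoMetricSpace β]
    [PseudoMetricSpace γ] {f : α → β} {g : α → γ} {s : Set α} (hg : TotallyBounded (g '' s))
    (h : ∀ ε > 0, ∃ δ > 0, ∀ x ∈ s, ∀ y ∈ s, dist (g x) (g y) < δ → dist (f x) (f y) < ε) :
    TotallyBounded (f '' s) := by
  refine Metric.totallyBounded_iff.2 fun ε hε => ?_
  obtain ⟨δ, hδ, hfg⟩ := h ε hε
  obtain ⟨t, hts, ht, hcover⟩ :=
    exists_subset_image_finite_and.1 (Metric.finite_approx_of_totallyBounded hg δ hδ)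
  refine ⟨f '' t, ht.image f, ?_⟩
  rintro _ ⟨x, hx, rfl⟩
  obtain ⟨_, ⟨y, hy, rfl⟩, hxy⟩ := mem_iUnion₂.1 (hcover (mem_image_of_mem g hx))
  exact mem_iUnion₂.2 ⟨f y, mem_image_of_mem f hy, hfg x hx y (hts hy) hxy⟩

theorem isCompactOperator_of_norm_le_rpow_mul_rpow {𝕜 X B Y : Type*} [NontriviallyNormedField 𝕜]
    [NormedAddCommGroup X] [NormedSpace 𝕜 X]
    [NormedAddCommGroup B] [NormedSpace 𝕜 B] [CompleteSpace B]
    [NormedAddCommGroup Y] [NormedSpace 𝕜 Y]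
    {f : X →L[𝕜] B} {g : X →L[𝕜] Y} (hg : IsCompactOperator g)
    {θ C : ℝ} (hθ0 : 0 < θ) (hθ1 : θ ≤ 1) (hC : 0 ≤ C)
    (hfg : ∀ x, ‖f x‖ ≤ C * ‖x‖ ^ (1 - θ) * ‖g x‖ ^ θ) :
    IsCompactOperator f := by
  suffices TotallyBounded (f '' Metric.closedBall 0 1) from
    (isCompactOperator_iff_isCompact_closure_image_closedBall (f : X →ₗ[𝕜] B) one_pos).2
      (this.closure.isCompact_of_isClosed isClosed_closure)
  have hg_ball : TotallyBounded (g '' Metric.closedBall 0 1) :=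
    (hg.isCompact_closure_image_closedBall (f := (g : X →ₗ[𝕜] Y)) 1).totallyBounded.subset
      subset_closure
  have hdist : ∀ x ∈ Metric.closedBall (0 : X) 1, ∀ y ∈ Metric.closedBall (0 : X) 1,
      dist (f x) (f y) ≤ C * 2 ^ (1 - θ) * dist (g x) (g y) ^ θ := by
    intro x hx y hy
    have hxy : ‖x - y‖ ≤ 2 := by
      rw [mem_closedBall_zero_iff] at hx hy
      linarith [norm_sub_le x y]
    rw [dist_eq_norm, dist_eq_norm, ← map_sub, ← map_sub]
    refine (hfg (x - y)).trans ?_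
    gcongr
  have hlim : Tendsto (fun d : ℝ => C * 2 ^ (1 - θ) * d ^ θ) (𝓝 0) (𝓝 0) := by
    simpa [Real.zero_rpow hθ0.ne'] using
      ((Real.continuous_rpow_const hθ0.le).tendsto 0).const_mul (C * 2 ^ (1 - θ))
  refine totallyBounded_image_of_forall_dist_lt hg_ball fun ε hε => ?_
  obtain ⟨δ, hδ, hδε⟩ := Metric.eventually_nhds_iff.1 (hlim.eventually_lt_const hε)
  refine ⟨δ, hδ, fun x hx y hy hxy => (hdist x hx y hy).trans_lt (hδε ?_)⟩
  rwa [Real.dist_0_eq_abs, abs_of_nonneg dist_nonneg]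

theorem sum_eVariationOn_Ioc_le {α E : Type*} [LinearOrder α] [PseudoEMetricSpace E] (f : α → E)
    {a : ℕ → α} (ha : Monotone a) (n : ℕ) :
    ∑ j ∈ Finset.range n, eVariationOn f (Ioc (a j) (a (j + 1))) ≤
      eVariationOn f (Ioc (a 0) (a n)) := by
  induction n with
  | zero => simp
  | succ n ih =>
    calc ∑ j ∈ Finset.range (n + 1), eVariationOn f (Ioc (a j) (a (j + 1)))
        ≤ eVariationOn f (Ioc (a 0) (a n)) + eVariationOn f (Ioc (a n) (a (n + 1))) := by
          rw [Finset.sum_range_succ]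
          gcongr
      _ ≤ eVariationOn f (Ioc (a 0) (a n) ∪ Ioc (a n) (a (n + 1))) :=
          eVariationOn.add_le_union f fun x hx y hy => hx.2.trans hy.1.le
      _ = eVariationOn f (Ioc (a 0) (a (n + 1))) := by
          rw [Ioc_union_Ioc_eq_Ioc (ha n.zero_le) (ha n.le_succ)]

theorem memLp_restrict_of_boundedVariationOn {α E : Type*} [LinearOrder α] [MeasurableSpace α]
    [NormedAddCommGroup E] {f : α → E} {s : Set α} (hf : BoundedVariationOn f s)
    (hs : MeasurableSet s) {μ : Measure α} [IsFiniteMeasure (μ.restrict s)]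
    (hfm : AEStronglyMeasurable f (μ.restrict s)) (q : ℝ≥0∞) :
    MemLp f q (μ.restrict s) := by
  obtain rfl | ⟨x, hx⟩ := s.eq_empty_or_nonempty
  · simp
  refine MemLp.of_bound hfm (‖f x‖ + (eVariationOn f s).toReal) ?_
  filter_upwards [ae_restrict_mem hs] with t ht
  calc ‖f t‖ ≤ ‖f x‖ + ‖f t - f x‖ := norm_le_norm_add_norm_sub' _ _
    _ ≤ ‖f x‖ + (eVariationOn f s).toReal := by
      rw [← dist_eq_norm]
      gcongr
      exact hf.dist_le ht hx

section StepFunctions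

variable {α κ E : Type*} [MeasurableSpace α] {μ : Measure α} [Fintype κ] [NormedAddCommGroup E]
  {q : ℝ≥0∞} {A : κ → Set α} (hA : ∀ k, MeasurableSet (A k)) (hμA : ∀ k, μ (A k) ≠ ∞)

variable (q) in
/-- The class in `L^q(μ; E)` of the step function `∑ k, 1_{A k} c k`. -/
noncomputable def stepLp (c : κ → E) : Lp E q μ :=
  ∑ k, indicatorConstLp q (hA k) (hμA k) (c k)

theorem continuous_stepLp [Fact (1 ≤ q)] :
    Continuous (stepLp q hA hμA : (κ → E) → Lp E q μ) := by
  have hlip : ∀ k, LipschitzWith ((μ (A k)).toNNReal ^ (1 / q.toReal))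
      fun x : E => indicatorConstLp q (hA k) (hμA k) x := fun k =>
    LipschitzWith.of_dist_le_mul fun x y => by
      rw [dist_eq_norm, dist_eq_norm, indicatorConstLp_sub, mul_comm]
      exact norm_indicatorConstLp_le
  exact continuous_finsetSum _ fun k _ => (hlip k).continuous.comp (continuous_apply k)

theorem stepLp_ae_eq_of_mem (hdisj : Pairwise (Function.onFun Disjoint A)) (c : κ → E) :
    ∀ᵐ t ∂μ, ∀ k, t ∈ A k → stepLp q hA hμA c t = c k := by
  have hsum : stepLp q hA hμA c =ᵐ[μ] ∑ k, ⇑(indicatorConstLp q (hA k) (hμA k) (c k)) :=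
    Lp.coeFn_finsetSum _ _
  have hmem := ae_all_iff.2 fun k =>
    indicatorConstLp_coeFn_mem (p := q) (hs := hA k) (hμs := hμA k) (c := c k)
  have hnotMem := ae_all_iff.2 fun k =>
    indicatorConstLp_coeFn_notMem (p := q) (hs := hA k) (hμs := hμA k) (c := c k)
  filter_upwards [hsum, hmem, hnotMem] with t hsum hmem hnotMem k hk
  rw [hsum, Finset.sum_apply, Finset.sum_eq_single k, hmem k hk]
  · exact fun j _ hjk => hnotMem j (disjoint_left.1 (hdisj hjk.symm) hk)
  · simp

theorem edist_toLp_stepLp_rpow_le (hdisj : Pairwise (Function.onFun Disjoint A))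
    (hcover : ∀ᵐ t ∂μ, t ∈ ⋃ k, A k) (hq0 : q ≠ 0) (hq : q ≠ ∞) {f : α → E} (hf : MemLp f q μ)
    (c : κ → E) {w : κ → ℝ≥0∞} (hw : ∀ k, ∀ t ∈ A k, edist (f t) (c k) ≤ w k) :
    edist (hf.toLp f) (stepLp q hA hμA c) ^ q.toReal ≤ ∑ k, w k ^ q.toReal * μ (A k) := by
  set g := stepLp q hA hμA c with hg
  have hpos : 0 < q.toReal := ENNReal.toReal_pos hq0 hq
  have hfg : edist (hf.toLp f) g = eLpNorm (f - ⇑g) q μ := by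
    rw [Lp.edist_def]
    exact eLpNorm_congr_ae (hf.coeFn_toLp.sub .rfl)
  calc edist (hf.toLp f) g ^ q.toReal
      = ∫⁻ t in ⋃ k, A k, ‖f t - g t‖ₑ ^ q.toReal ∂μ := by
        rw [hfg, eLpNorm_eq_lintegral_rpow_enorm_toReal hq0 hq, ← ENNReal.rpow_mul,
          one_div_mul_cancel hpos.ne', ENNReal.rpow_one, Measure.restrict_eq_self_of_ae_mem hcover]
        rfl
    _ ≤ ∑ k, ∫⁻ t in A k, ‖f t - g t‖ₑ ^ q.toReal ∂μ := by
        rw [← tsum_fintype (L := .unconditional _)]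
        exact lintegral_iUnion_le _ _
    _ ≤ ∑ k, w k ^ q.toReal * μ (A k) := by
        refine Finset.sum_le_sum fun k _ => ?_
        rw [← setLIntegral_const]
        refine setLIntegral_mono_ae' (hA k) ?_
        filter_upwards [stepLp_ae_eq_of_mem hA hμA hdisj c] with t ht htk
        rw [hg, ht k htk, ← edist_eq_enorm_sub]
        gcongr
        exact hw k t htk

end StepFunctions

theorem sum_rpow_le_rpow_sum {κ : Type*} (s : Finset κ) (a : κ → ℝ≥0∞) {r : ℝ} (hr : 1 ≤ r) :
    ∑ k ∈ s, a k ^ r ≤ (∑ k ∈ s, a k) ^ r := by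
  classical
  induction s using Finset.induction_on with
  | empty => simp
  | insert k s hk ih =>
    rw [Finset.sum_insert hk, Finset.sum_insert hk]
    exact (add_le_add_right ih _).trans (ENNReal.add_rpow_le_rpow_add _ _ hr)

theorem edist_toLp_stepLp_le_eVariationOn {α E : Type*} [LinearOrder α] [MeasurableSpace α]
    [NormedAddCommGroup E] {μ : Measure α} {q : ℝ≥0∞} (hq1 : 1 ≤ q) (hq : q ≠ ∞)
    {a : ℕ → α} (ha : Monotone a) {n : ℕ}
    (hcover : ∀ᵐ t ∂μ, t ∈ Ioc (a 0) (a n))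
    (hmeas : ∀ j : Fin n, MeasurableSet (Ioc (a j) (a ((j : ℕ) + 1))))
    (hfin : ∀ j : Fin n, μ (Ioc (a j) (a ((j : ℕ) + 1))) ≠ ∞)
    {h : ℝ≥0∞} (hmesh : ∀ j : Fin n, μ (Ioc (a j) (a ((j : ℕ) + 1))) ≤ h)
    {f : α → E} (hf : MemLp f q μ) {s : Fin n → α}
    (hs : ∀ j : Fin n, s j ∈ Ioc (a j) (a ((j : ℕ) + 1))) :
    edist (hf.toLp f) (stepLp q hmeas hfin fun j : Fin n => f (s j)) ≤
      h ^ (1 / q.toReal) * eVariationOn f (Ioc (a 0) (a n)) := by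
  have hr : 1 ≤ q.toReal := by simpa using ENNReal.toReal_mono hq hq1
  have hpos : 0 < q.toReal := one_pos.trans_le hr
  have hdisj : Pairwise (Function.onFun Disjoint fun j : Fin n => Ioc (a j) (a ((j : ℕ) + 1))) :=
    fun i j hij => ha.pairwise_disjoint_on_Ioc_succ (Fin.val_injective.ne hij)
  have hunion : ⋃ j : Fin n, Ioc (a j) (a ((j : ℕ) + 1)) = Ioc (a 0) (a n) := by
    rw [← ha.biUnion_Ico_Ioc_map_succ 0 n]
    ext t
    simp [Fin.exists_iff]
  rw [← ENNReal.rpow_le_rpow_iff hpos]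
  calc edist (hf.toLp f) (stepLp q hmeas hfin fun j : Fin n => f (s j)) ^ q.toReal
      ≤ ∑ j : Fin n, eVariationOn f (Ioc (a j) (a ((j : ℕ) + 1))) ^ q.toReal *
          μ (Ioc (a j) (a ((j : ℕ) + 1))) :=
        edist_toLp_stepLp_rpow_le hmeas hfin hdisj (hunion ▸ hcover) (one_pos.trans_le hq1).ne' hq
          hf _ fun j t ht => eVariationOn.edist_le f ht (hs j)
    _ ≤ ∑ j : Fin n, eVariationOn f (Ioc (a j) (a ((j : ℕ) + 1))) ^ q.toReal * h := by
        gcongr with j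
        exact hmesh j
    _ ≤ (∑ j : Fin n, eVariationOn f (Ioc (a j) (a ((j : ℕ) + 1)))) ^ q.toReal * h := by
        rw [← Finset.sum_mul]
        gcongr
        exact sum_rpow_le_rpow_sum _ _ hr
    _ ≤ eVariationOn f (Ioc (a 0) (a n)) ^ q.toReal * h := by
        gcongr
        rw [Fin.sum_univ_eq_sum_range fun j => eVariationOn f (Ioc (a j) (a (j + 1)))]
        exact sum_eVariationOn_Ioc_le f ha n
    _ = (h ^ (1 / q.toReal) * eVariationOn f (Ioc (a 0) (a n))) ^ q.toReal := by
        rw [ENNReal.mul_rpow_of_nonneg _ _ hpos.le, ← ENNReal.rpow_mul,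
          one_div_mul_cancel hpos.ne', ENNReal.rpow_one, mul_comm]

theorem timeMeasure_eq_restrict_Ioc (a b : ℝ) : timeMeasure a b = volume.restrict (Ioc a b) :=
  Measure.restrict_congr_set Ioo_ae_eq_Ioc

instance isFiniteMeasure_timeMeasure (a b : ℝ) : IsFiniteMeasure (timeMeasure a b) := by
  unfold timeMeasure
  infer_instance

theorem exists_totallyBounded_forall_edist_toLp_le {E : Type*} [NormedAddCommGroup E] {q : ℝ≥0∞}
    [hq1 : Fact (1 ≤ q)] (hq : q ≠ ∞) (n : ℕ) {h : ℝ} (hh : 0 ≤ h) {K : Set E} (hK : IsCompact K) :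
    ∃ S : Set (Lp E q (timeMeasure 0 (n * h))), TotallyBounded S ∧
      ∀ (f : ℝ → E) (hf : MemLp f q (timeMeasure 0 (n * h))),
        (∀ k < n, ∃ t ∈ Ioc (k * h) ((k + 1 : ℕ) * h), f t ∈ K) →
          ∃ g ∈ S, edist (hf.toLp f) g ≤
            ENNReal.ofReal h ^ (1 / q.toReal) * eVariationOn f (Ioc 0 (n * h)) := by
  have ha : Monotone fun j : ℕ => (j : ℝ) * h := fun i j hij => by
    beta_reduce
    gcongr
  have hmeas : ∀ j : Fin n, MeasurableSet (Ioc ((j : ℕ) * h) (((j : ℕ) + 1 : ℕ) * h)) :=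
    fun j => measurableSet_Ioc
  have hfin : ∀ j : Fin n,
      timeMeasure 0 (n * h) (Ioc ((j : ℕ) * h) (((j : ℕ) + 1 : ℕ) * h)) ≠ ∞ :=
    fun j => measure_ne_top _ _
  refine ⟨stepLp q hmeas hfin '' univ.pi fun _ => K,
    ((isCompact_univ_pi fun _ => hK).image (continuous_stepLp hmeas hfin)).totallyBounded, ?_⟩
  intro f hf hsample
  have hsample_fin : ∀ j : Fin n, ∃ t ∈ Ioc ((j : ℕ) * h) (((j : ℕ) + 1 : ℕ) * h), f t ∈ K :=
    fun j => hsample j j.isLt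
  choose s hs hsK using hsample_fin
  refine ⟨_, mem_image_of_mem _ fun j _ => hsK j, ?_⟩
  have hcover : ∀ᵐ t ∂timeMeasure 0 (n * h), t ∈ Ioc ((0 : ℕ) * h) (n * h) := by
    rw [Nat.cast_zero, zero_mul, timeMeasure_eq_restrict_Ioc]
    exact ae_restrict_mem measurableSet_Ioc
  have hmesh : ∀ j : Fin n, timeMeasure 0 (n * h)
      (Ioc ((j : ℕ) * h) (((j : ℕ) + 1 : ℕ) * h)) ≤ ENNReal.ofReal h := fun j =>
    (Measure.restrict_le_self _).trans_eq <| by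
      rw [Real.volume_Ioc, Nat.cast_succ, add_one_mul, add_sub_cancel_left]
  simpa using edist_toLp_stepLp_le_eVariationOn hq1.out hq ha hcover hmeas hfin hmesh hf hs

theorem totallyBounded_range_toLp_of_eVariationOn_le {ι E : Type*} [NormedAddCommGroup E]
    {q : ℝ≥0∞} [hq1 : Fact (1 ≤ q)] (hq : q ≠ ∞) {T : ℝ} (hT : 0 < T) {v : ι → ℝ → E}
    (hv : ∀ i, MemLp (v i) q (timeMeasure 0 T))
    {V : ℝ≥0∞} (hV : V ≠ ∞) (hvar : ∀ i, eVariationOn (v i) (Ioc 0 T) ≤ V)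
    (hval : ∀ h > 0, ∃ K : Set E, IsCompact K ∧
      ∀ i a, 0 ≤ a → a + h ≤ T → ∃ t ∈ Ioc a (a + h), v i t ∈ K) :
    TotallyBounded (range fun i => (hv i).toLp (v i)) := by
  refine totallyBounded_of_forall_exists_totallyBounded_edist_lt fun ε hε => ?_
  have hlim : Tendsto (fun n : ℕ => ENNReal.ofReal (T / n) ^ (1 / q.toReal) * V) atTop (𝓝 0) := by
    have hr : 0 < 1 / q.toReal :=
      one_div_pos.2 (ENNReal.toReal_pos (one_pos.trans_le hq1.out).ne' hq)
    have hmesh := ((ENNReal.continuous_rpow_const (y := 1 / q.toReal)).tendsto _).comp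
      (ENNReal.tendsto_ofReal (tendsto_const_div_atTop_nhds_zero_nat T))
    rw [ENNReal.ofReal_zero, ENNReal.zero_rpow_of_pos hr] at hmesh
    simpa only [zero_mul, Function.comp_apply] using ENNReal.Tendsto.mul_const hmesh (Or.inr hV)
  obtain ⟨n, hnε, hn⟩ := ((hlim.eventually_lt_const hε).and (eventually_gt_atTop 0)).exists
  have hn_pos : (0 : ℝ) < n := Nat.cast_pos.2 hn
  obtain ⟨h, rfl⟩ : ∃ h, T = n * h := ⟨T / n, by field_simp⟩
  have hh : 0 < h := pos_of_mul_pos_right hT hn_pos.le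
  rw [mul_div_cancel_left₀ h hn_pos.ne'] at hnε
  obtain ⟨K, hK, hKv⟩ := hval h hh
  obtain ⟨S, hS, happrox⟩ := exists_totallyBounded_forall_edist_toLp_le (q := q) hq n hh.le hK
  refine ⟨S, hS, ?_⟩
  rintro _ ⟨i, rfl⟩
  have hsample : ∀ k < n, ∃ t ∈ Ioc (k * h) ((k + 1 : ℕ) * h), v i t ∈ K := fun k hk => by
    have hkn : ((k + 1 : ℕ) : ℝ) * h ≤ n * h := by
      gcongr
      exact hk
    rw [Nat.cast_succ, add_one_mul] at hkn ⊢
    exact hKv i _ (by positivity) hkn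
  obtain ⟨g, hg, hle⟩ := happrox (v i) (hv i) hsample
  refine ⟨g, hg, hle.trans_lt (lt_of_le_of_lt ?_ hnε)⟩
  gcongr
  exact hvar i

theorem isRelativelyCompactInLp_of_eVariationOn_le {ι E : Type*} [NormedAddCommGroup E]
    [CompleteSpace E] {q : ℝ≥0∞} (hq1 : 1 ≤ q) (hq : q ≠ ∞) {T : ℝ} (hT : 0 < T) {v : ι → ℝ → E}
    (hv : ∀ i, AEStronglyMeasurable (v i) (timeMeasure 0 T))
    {V : ℝ≥0∞} (hV : V ≠ ∞) (hvar : ∀ i, eVariationOn (v i) (Ioc 0 T) ≤ V)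
    (hval : ∀ h > 0, ∃ K : Set E, IsCompact K ∧
      ∀ i a, 0 ≤ a → a + h ≤ T → ∃ t ∈ Ioc a (a + h), v i t ∈ K) :
    IsRelativelyCompactInLp q T v := by
  have : Fact (1 ≤ q) := ⟨hq1⟩
  have hbv : ∀ i, BoundedVariationOn (v i) (Ioo 0 T) := fun i =>
    BoundedVariationOn.mono (ne_top_of_le_ne_top hV (hvar i)) Ioo_subset_Ioc_self
  have hmem : ∀ i, MemLp (v i) q (timeMeasure 0 T) := fun i =>
    memLp_restrict_of_boundedVariationOn (hbv i) measurableSet_Ioo (hv i) q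
  exact ⟨this, hmem, (totallyBounded_range_toLp_of_eVariationOn_le hq hT hmem hV hvar
    hval).closure.isCompact_of_isClosed isClosed_closure⟩

theorem exists_mem_enorm_lt_of_eLpNorm_lt {α E : Type*} [MeasurableSpace α]
    [NormedAddCommGroup E] {μ : Measure α} {s : Set α} (hs : MeasurableSet s) (hμs : μ s ≠ 0)
    {p : ℝ≥0∞} (hp : p ≠ 0) {f : α → E} {R : ℝ≥0∞}
    (hf : eLpNorm f p (μ.restrict s) < R * μ s ^ (1 / p.toReal)) :
    ∃ t ∈ s, ‖f t‖ₑ < R := by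
  contrapose! hf
  have hconst := eLpNorm_const (ε := ℝ≥0∞) (μ := μ.restrict s) R hp
    (by rwa [Ne, Measure.restrict_eq_zero])
  rw [Measure.restrict_apply_univ] at hconst
  rw [← enorm_eq_self R, ← hconst]
  exact eLpNorm_mono_enorm_ae ((ae_restrict_mem hs).mono hf)

theorem IsBoundedInLp.exists_forall_exists_mem_Ioc_norm_le {ι E : Type*} [NormedAddCommGroup E]
    {p : ℝ≥0∞} (hp : p ≠ 0) {T : ℝ} {u : ι → ℝ → E} (hu : IsBoundedInLp p T u)
    {h : ℝ} (hh : 0 < h) :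
    ∃ R : ℝ, ∀ i a, 0 ≤ a → a + h ≤ T → ∃ t ∈ Ioc a (a + h), ‖u i t‖ ≤ R := by
  obtain ⟨-, M, hM⟩ := hu
  have hlen : ENNReal.ofReal h ^ (1 / p.toReal) ≠ 0 := by
    simp [ENNReal.rpow_eq_zero_iff, hh]
  obtain ⟨n, hn⟩ := ENNReal.exists_nat_mul_gt hlen (ENNReal.ofReal_ne_top (r := M))
  refine ⟨n, fun i a ha haT => ?_⟩
  have hvol : volume (Ioc a (a + h)) = ENNReal.ofReal h := by simp
  have hle : eLpNorm (u i) p (volume.restrict (Ioc a (a + h))) ≤ ENNReal.ofReal M := by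
    refine (eLpNorm_mono_measure _ ?_).trans (hM i)
    rw [timeMeasure_eq_restrict_Ioc]
    exact Measure.restrict_mono_set _ (Ioc_subset_Ioc ha haT)
  obtain ⟨t, ht, htn⟩ := exists_mem_enorm_lt_of_eLpNorm_lt measurableSet_Ioc
    (by simpa [hvol] using hh) hp (hle.trans_lt (hvol ▸ hn))
  refine ⟨t, ht, ?_⟩
  rw [← toReal_enorm]
  simpa using ENNReal.toReal_mono (ENNReal.natCast_ne_top n) htn.le

namespace IsPiecewiseConstantInTime

variable {E F : Type*} {T τ : ℝ} {f : ℝ → E}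

theorem comp_left (hf : IsPiecewiseConstantInTime T τ f) (g : E → F) :
    IsPiecewiseConstantInTime T τ fun t => g (f t) := by
  obtain ⟨N, hT, hconst⟩ := hf
  refine ⟨N, hT, fun k hk hkN => ?_⟩
  obtain ⟨c, hc⟩ := hconst k hk hkN
  exact ⟨g c, fun t ht => congrArg g (hc t ht)⟩

theorem step_pos (hf : IsPiecewiseConstantInTime T τ f) (hT : 0 < T) : 0 < τ := by
  obtain ⟨N, rfl, -⟩ := hf
  exact pos_of_mul_pos_right hT N.cast_nonneg

theorem exists_eq_right_endpoint (hf : IsPiecewiseConstantInTime T τ f) :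
    ∃ N : ℕ, T = N * τ ∧
      ∀ k < N, ∀ t ∈ Ioc ((k : ℝ) * τ) ((k + 1 : ℕ) * τ), f t = f ((k + 1 : ℕ) * τ) := by
  obtain ⟨N, hT, hconst⟩ := hf
  refine ⟨N, hT, fun k hk t ht => ?_⟩
  obtain ⟨c, hc⟩ := hconst (k + 1) k.succ_pos hk
  rw [Nat.cast_succ, add_sub_cancel_right, ← Nat.cast_succ] at hc
  exact (hc t ht).trans (hc _ (right_mem_Ioc.2 (ht.1.trans_le ht.2))).symm

end IsPiecewiseConstantInTime

theorem eVariationOn_Ioc_le_sum_edist {E : Type*} [PseudoEMetricSpace E] {f : ℝ → E} {τ : ℝ}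
    (hτ : 0 < τ) (n : ℕ)
    (hf : ∀ k < n + 1, ∀ t ∈ Ioc ((k : ℝ) * τ) ((k + 1 : ℕ) * τ), f t = f ((k + 1 : ℕ) * τ)) :
    eVariationOn f (Ioc 0 ((n + 1 : ℕ) * τ)) ≤
      ∑ k ∈ Finset.range n, edist (f ((k + 1 : ℕ) * τ)) (f ((k + 2 : ℕ) * τ)) := by
  have hceil : ∀ t ∈ Ioc 0 ((n + 1 : ℕ) * τ), ∃ k < n + 1, ⌈t / τ⌉₊ = k + 1 := by
    intro t ht
    have hpos : 0 < ⌈t / τ⌉₊ := Nat.ceil_pos.2 (div_pos ht.1 hτ)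
    have hle : ⌈t / τ⌉₊ ≤ n + 1 := Nat.ceil_le.2 ((div_le_iff₀ hτ).2 ht.2)
    exact ⟨⌈t / τ⌉₊ - 1, by omega, by omega⟩
  have hround : EqOn f (f ∘ fun t => ⌈t / τ⌉₊ * τ) (Ioc 0 ((n + 1 : ℕ) * τ)) := by
    intro t ht
    obtain ⟨k, hk, hkt⟩ := hceil t ht
    have hcell := (Nat.ceil_eq_iff k.succ_ne_zero).1 hkt
    rw [lt_div_iff₀ hτ, div_le_iff₀ hτ, Nat.succ_sub_one] at hcell
    rw [Function.comp_apply, hkt]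
    exact hf k hk t hcell
  have hmono : Monotone fun k : ℕ => ((k + 1 : ℕ) : ℝ) * τ := fun i j hij => by
    beta_reduce
    gcongr
  calc eVariationOn f (Ioc 0 ((n + 1 : ℕ) * τ))
      = eVariationOn (f ∘ fun t => ⌈t / τ⌉₊ * τ) (Ioc 0 ((n + 1 : ℕ) * τ)) :=
        eVariationOn.congr hround
    _ ≤ eVariationOn f ((fun k : ℕ => ((k + 1 : ℕ) : ℝ) * τ) '' Iic n) := by
        refine eVariationOn.comp_le_of_monotoneOn f _ (fun s _ t _ hst => ?_) fun t ht => ?_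
        · gcongr
        · obtain ⟨k, hk, hkt⟩ := hceil t ht
          exact ⟨k, Nat.le_of_lt_succ hk, by simp only [hkt]⟩
    _ = ∑ k ∈ Finset.range n, edist (f ((k + 1 : ℕ) * τ)) (f ((k + 2 : ℕ) * τ)) :=
        eVariationOn.image_range_of_monotone f hmono n

theorem setLIntegral_enorm_translate_sub {E : Type*} [NormedAddCommGroup E] {f : ℝ → E} {τ : ℝ}
    {k : ℕ} (hf : ∀ t ∈ Ioc ((k : ℝ) * τ) ((k + 1 : ℕ) * τ), f t = f ((k + 1 : ℕ) * τ))
    (hf_next : ∀ t ∈ Ioc (((k + 1 : ℕ) : ℝ) * τ) ((k + 2 : ℕ) * τ), f t = f ((k + 2 : ℕ) * τ)) :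
    ∫⁻ t in Ioc ((k : ℝ) * τ) ((k + 1 : ℕ) * τ), ‖f (t + τ) - f t‖ₑ =
      ENNReal.ofReal τ * edist (f ((k + 1 : ℕ) * τ)) (f ((k + 2 : ℕ) * τ)) := by
  have hjump : ∀ t ∈ Ioc ((k : ℝ) * τ) ((k + 1 : ℕ) * τ), ‖f (t + τ) - f t‖ₑ =
      edist (f ((k + 1 : ℕ) * τ)) (f ((k + 2 : ℕ) * τ)) := fun t ht => by
    have ht_next : t + τ ∈ Ioc (((k + 1 : ℕ) : ℝ) * τ) ((k + 2 : ℕ) * τ) := by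
      push_cast at ht ⊢
      exact ⟨by linarith [ht.1], by linarith [ht.2]⟩
    rw [hf t ht, hf_next _ ht_next, edist_comm, edist_eq_enorm_sub]
  rw [setLIntegral_congr_fun measurableSet_Ioc hjump, setLIntegral_const, Real.volume_Ioc,
    Nat.cast_succ, add_one_mul, add_sub_cancel_left, mul_comm]

theorem IsPiecewiseConstantInTime.mul_eVariationOn_le_eLpNorm_translate_sub {E : Type*}
    [NormedAddCommGroup E] {T τ : ℝ} {f : ℝ → E} (hf : IsPiecewiseConstantInTime T τ f)
    (hτ : 0 < τ) :
    ENNReal.ofReal τ * eVariationOn f (Ioc 0 T) ≤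
      eLpNorm (fun t => f (t + τ) - f t) 1 (timeMeasure 0 (T - τ)) := by
  obtain ⟨N, rfl, hconst⟩ := hf.exists_eq_right_endpoint
  obtain _ | n := N
  · simp
  have ha : Monotone fun k : ℕ => (k : ℝ) * τ := fun i j hij => by
    beta_reduce
    gcongr
  have hdisj : (Finset.range n : Set ℕ).PairwiseDisjoint
      fun k : ℕ => Ioc ((k : ℝ) * τ) ((k + 1 : ℕ) * τ) :=
    fun i _ j _ hij => ha.pairwise_disjoint_on_Ioc_succ hij
  have hunion : ⋃ k ∈ Finset.range n, Ioc ((k : ℝ) * τ) ((k + 1 : ℕ) * τ) =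
      Ioc 0 ((n + 1 : ℕ) * τ - τ) := by
    have hcells := ha.biUnion_Ico_Ioc_map_succ 0 n
    simpa [add_one_mul] using hcells
  calc ENNReal.ofReal τ * eVariationOn f (Ioc 0 ((n + 1 : ℕ) * τ))
      ≤ ENNReal.ofReal τ *
          ∑ k ∈ Finset.range n, edist (f ((k + 1 : ℕ) * τ)) (f ((k + 2 : ℕ) * τ)) := by
        gcongr
        exact eVariationOn_Ioc_le_sum_edist hτ n hconst
    _ = ∑ k ∈ Finset.range n, ∫⁻ t in Ioc ((k : ℝ) * τ) ((k + 1 : ℕ) * τ),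
          ‖f (t + τ) - f t‖ₑ := by
        rw [Finset.mul_sum]
        refine Finset.sum_congr rfl fun k hk => ?_
        have hkn := Finset.mem_range.1 hk
        exact (setLIntegral_enorm_translate_sub (hconst k (by omega))
          (hconst (k + 1) (by omega))).symm
    _ = eLpNorm (fun t => f (t + τ) - f t) 1 (timeMeasure 0 ((n + 1 : ℕ) * τ - τ)) := by
        rw [eLpNorm_one_eq_lintegral_enorm, timeMeasure_eq_restrict_Ioc, ← hunion,
          lintegral_biUnion_finset hdisj fun _ _ => measurableSet_Ioc]

theorem mainTheorem6_general {𝕜 X B : Type*} [NontriviallyNormedField 𝕜]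
    [NormedAddCommGroup X] [NormedSpace 𝕜 X]
    [NormedAddCommGroup B] [NormedSpace 𝕜 B] [CompleteSpace B]
    {e : X →L[𝕜] B} (he : IsCompactOperator e)
    {p : ℝ≥0∞} (hp : p ≠ 0) {T : ℝ} (hT : 0 < T)
    {ι : Type*} {τ : ι → ℝ} {u : ι → ℝ → X}
    (hpw : ∀ i, IsPiecewiseConstantInTime T (τ i) (u i))
    (hbdd : IsBoundedInLp p T u)
    (hshift : ∃ C : ℝ, ∀ i,
      eLpNorm (fun t => e (u i (t + τ i)) - e (u i t)) 1 (timeMeasure 0 (T - τ i))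
        ≤ ENNReal.ofReal (C * τ i))
    {q : ℝ≥0∞} (hq1 : 1 ≤ q) (hq : q ≠ ∞) :
    IsRelativelyCompactInLp q T fun i t => e (u i t) := by
  obtain ⟨C, hC⟩ := hshift
  have hvar : ∀ i, eVariationOn (fun t => e (u i t)) (Ioc 0 T) ≤ ENNReal.ofReal C := fun i => by
    have hτ := (hpw i).step_pos hT
    have hle := (((hpw i).comp_left e).mul_eVariationOn_le_eLpNorm_translate_sub hτ).trans (hC i)
    rw [mul_comm C, ENNReal.ofReal_mul hτ.le] at hle
    exact (ENNReal.mul_le_mul_iff_right (by simpa using hτ) ENNReal.ofReal_ne_top).1 hle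
  refine isRelativelyCompactInLp_of_eVariationOn_le hq1 hq hT
    (fun i => e.continuous.comp_aestronglyMeasurable (hbdd.1 i).1) ENNReal.ofReal_ne_top hvar
    fun h hh => ?_
  obtain ⟨R, hR⟩ := hbdd.exists_forall_exists_mem_Ioc_norm_le hp hh
  obtain ⟨K, hK, hKR⟩ := he.image_closedBall_subset_compact (f := (e : X →ₗ[𝕜] B)) R
  refine ⟨K, hK, fun i a ha haT => ?_⟩
  obtain ⟨t, ht, htR⟩ := hR i a ha haT
  exact ⟨t, ht, hKR (mem_image_of_mem e (mem_closedBall_zero_iff.2 htR))⟩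

theorem mainTheorem6 {𝕜 : Type*} [RCLike 𝕜]
    {X B Y : Type*}
    [NormedAddCommGroup X] [NormedSpace 𝕜 X] [CompleteSpace X]
    [NormedAddCommGroup B] [NormedSpace 𝕜 B] [CompleteSpace B]
    [NormedAddCommGroup Y] [NormedSpace 𝕜 Y] [CompleteSpace Y]
    -- the continuous embeddings of `X` into `B` and of `B` into `Y`
    (eXB : X →L[𝕜] B) (heXB : Function.Injective eXB)
    (eBY : B →L[𝕜] Y) (heBY : Function.Injective eBY)
    -- the embedding of `X` into `Y` is compact
    (hcompact : IsCompactOperator (eBY.comp eXB))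
    (θ : ℝ) (hθ0 : 0 < θ) (hθ1 : θ < 1)
    (Cθ : ℝ) (hCθ : 0 < Cθ)
    (hinterp : ∀ x : X, ‖eXB x‖ ≤ Cθ * ‖x‖ ^ (1 - θ) * ‖eBY (eXB x)‖ ^ θ)
    (p : ℝ) (hp : 1 ≤ p) (T : ℝ) (hT : 0 < T)
    -- the functions `u i`, with time steps `τ i`
    {ι : Type*} (τ : ι → ℝ) (u : ι → ℝ → X)
    (hpw : ∀ i, IsPiecewiseConstantInTime T (τ i) (u i))
    (hbdd : IsBoundedInLp (ENNReal.ofReal p) T u)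
    (hshift : ∃ C : ℝ, 0 < C ∧ ∀ i,
      eLpNorm (fun t => eXB (u i (t + τ i)) - eXB (u i t)) 1 (timeMeasure 0 (T - τ i))
        ≤ ENNReal.ofReal (C * τ i)) :
    ∀ q : ℝ, p ≤ q → q < p / (1 - θ) →
      IsRelativelyCompactInLp (ENNReal.ofReal q) T (fun i t => eXB (u i t)) := by
  obtain ⟨C, _, hC⟩ := hshift
  exact fun q hpq _ => mainTheorem6_general
    (isCompactOperator_of_norm_le_rpow_mul_rpow hcompact hθ0 hθ1.le hCθ.le hinterp)
    (ENNReal.ofReal_pos.2 (one_pos.trans_le hp)).ne' hT hpw hbdd ⟨C, hC⟩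
    (ENNReal.one_le_ofReal.2 (hp.trans hpq)) ENNReal.ofReal_ne_top
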